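/- Let $\lambda$ be a $\sigma$-finite measure on $\mathbb R$ and let $\Theta\subset\mathbb R$ be a compact set with non-empty interior and finitely many connected components (for instance a compact interval of positive length). For each $\theta\in\Theta$ let $f(\cdot,\theta)$ be a probability density on $\mathbb R$ with respect to $\lambda$, and put $F(x,\theta)=\int_{(-\infty,x]}f(y,\theta)\,d\lambda(y)$. Write $F'(x,\theta)$ for the derivative with respect to $\theta$, taken relative to $\Theta$; at an isolated point of $\Theta$ it is understood to be $0$, so that (2) below rules out isolated points. For $j\ge 1$ let $\mathcal G_j$ be the set of probability measures on $\Theta$ with exactly $j$ support points, let $\mathcal G_{\le m}=\bigcup_{j=1}^m\mathcal G_j$, and for such a measure $G$ put $F(x,G)=\int_\Theta F(x,\theta)\,dG(\theta)$. Let $$W(G_1,G_2)=\inf_{\Pi}\int_{\Theta\times\Theta}|\theta-\theta'|\,d\Pi(\theta,\theta'),$$ the infimum being over probability measures $\Pi$ on $\Theta\times\Theta$ with marginals $G_1$ and $G_2$, and let $\|\cdot\|_\infty$ be the supremum norm in $x\in\mathbb R$. Assume B(1), that is: 1. for every $x$, the function $\theta\mapsto F(x,\theta)$ is differentiable on $\Theta$;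 2. (1-strong identifiability) for every finite set of distinct points $\theta_1,\dots,\theta_r\in\Theta$ and all real $\alpha_j,\beta_j$, if $\big\|\sum_{j=1}^r\big(\alpha_jF(\cdot,\theta_j)+\beta_jF'(\cdot,\theta_j)\big)\big\|_\infty=0$, then $\alpha_j=\beta_j=0$ for all $j$; 3. there is a function $\omega$ with $\lim_{h\to0}\omega(h)=0$ such that $\sup_x|F'(x,\theta_2)-F'(x,\theta_1)|\le\omega(\theta_2-\theta_1)$ for all $\theta_1,\theta_2\in\Theta$. Let $m\ge1$ and $G_0\in\mathcal G_m$. Then there are $\varepsilon>0$ and $\delta>0$ such that $$\inf_{\substack{G_1,G_2\in\mathcal G_{\le m},\ G_1\ne G_2\\ W(G_1,G_0)<\varepsilon,\ W(G_2,G_0)<\varepsilon}}\ \frac{\|F(\cdot,G_1)-F(\cdot,G_2)\|_\infty}{W(G_1,G_2)}>\delta .$$ -/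

import Mathlib

open MeasureTheory Filter Topology
open scoped ENNReal

noncomputable section

namespace FiniteMixture

/-- The functions `x ↦ f x θ`, `θ ∈ Θ`, are probability densities on `ℝ` with respect to `ν`. -/
structure IsDensityFamily (ν : Measure ℝ) (Θ : Set ℝ) (f : ℝ → ℝ → ℝ) : Prop where
  nonneg : ∀ θ ∈ Θ, ∀ᵐ x ∂ν, 0 ≤ f x θ
  integrable : ∀ θ ∈ Θ, Integrable (fun x => f x θ) ν
  integral_eq_one : ∀ θ ∈ Θ, ∫ x, f x θ ∂ν = 1

/-- The distribution function `F(x, θ)`, the integral of `f(·, θ)` over `(-∞, x]`. -/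
def distFun (ν : Measure ℝ) (f : ℝ → ℝ → ℝ) (x θ : ℝ) : ℝ :=
  ∫ y in Set.Iic x, f y θ ∂ν

/-- The distribution function `F(x, G) = ∫ F(x, θ) dG(θ)` of the mixture
with mixing distribution `G`. -/
def mixDistFun (ν : Measure ℝ) (f : ℝ → ℝ → ℝ) (x : ℝ) (G : Measure ℝ) : ℝ :=
  ∫ θ, distFun ν f x θ ∂G

/-- The `p`-th derivative `F^{(p)}(x, θ)` in the variable `θ`, taken relative to `Θ`
(so one-sided at an end point of a component of `Θ`). Its value is `0` at an isolated point
of `Θ` when `1 ≤ p`. -/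
def distFunDeriv (ν : Measure ℝ) (Θ : Set ℝ) (f : ℝ → ℝ → ℝ) (p : ℕ) (x θ : ℝ) : ℝ :=
  iteratedDerivWithin p (fun t => distFun ν f x t) Θ θ

/-- The supremum norm of a real function on `ℝ`, with values in `[0, ∞]`. -/
def supNorm (g : ℝ → ℝ) : ℝ≥0∞ :=
  ⨆ x, ENNReal.ofReal |g x|

/-- `k`-strong identifiability of the family `F(·, θ)`, `θ ∈ Θ`. -/
def StronglyIdentifiable (ν : Measure ℝ) (Θ : Set ℝ) (f : ℝ → ℝ → ℝ) (k : ℕ) : Prop :=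
  ∀ (s : Finset ℝ) (α : ℕ → ℝ → ℝ), (s : Set ℝ) ⊆ Θ →
    supNorm (fun x =>
      ∑ p ∈ Finset.range (k + 1), ∑ θ ∈ s, α p θ * distFunDeriv ν Θ f p x θ) = 0 →
    ∀ p ≤ k, ∀ θ ∈ s, α p θ = 0

/-- Assumption B(k) on the family of densities `f(·, θ)`, `θ ∈ Θ`. -/
structure AssumptionB (ν : Measure ℝ) (Θ : Set ℝ) (f : ℝ → ℝ → ℝ) (k : ℕ) : Prop where
  /-- `θ ↦ F(x, θ)` is `k` times differentiable on `Θ`, for every `x`. -/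
  differentiable : ∀ x, ∀ p < k, DifferentiableOn ℝ (fun θ => distFunDeriv ν Θ f p x θ) Θ
  identifiable : StronglyIdentifiable ν Θ f k
  /-- `F^{(k)}(x, θ)` has a modulus of continuity in `θ` that is uniform in `x`. -/
  modulus : ∃ ω : ℝ → ℝ, Tendsto ω (𝓝[≠] 0) (𝓝 0) ∧
    ∀ θ₁ ∈ Θ, ∀ θ₂ ∈ Θ, ∀ x,
      |distFunDeriv ν Θ f k x θ₂ - distFunDeriv ν Θ f k x θ₁| ≤ ω (θ₂ - θ₁)

/-- Mixing distributions on `Θ` with exactly `m` support points. -/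
def mixing (Θ : Set ℝ) (m : ℕ) : Set (Measure ℝ) :=
  {G | IsProbabilityMeasure G ∧ ∃ s : Finset ℝ, (s : Set ℝ) ⊆ Θ ∧ s.card = m ∧
    (∀ θ ∈ s, 0 < G {θ}) ∧ G (s : Set ℝ)ᶜ = 0}

/-- Mixing distributions on `Θ` with at most `m` support points. -/
def mixingLE (Θ : Set ℝ) (m : ℕ) : Set (Measure ℝ) :=
  ⋃ j ∈ Set.Icc 1 m, mixing Θ j

/-- All finite mixing distributions on `Θ`. -/
def mixingFinite (Θ : Set ℝ) : Set (Measure ℝ) :=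
  ⋃ j, mixing Θ j

/-- The `L¹`-transportation (Wasserstein) distance: the infimum over all couplings of the
transportation cost. A coupling of two measures carried by `Θ` is carried by `Θ × Θ`. -/
def W (G₁ G₂ : Measure ℝ) : ℝ≥0∞ :=
  ⨅ P ∈ {P : Measure (ℝ × ℝ) | P.map Prod.fst = G₁ ∧ P.map Prod.snd = G₂},
    ∫⁻ q, ENNReal.ofReal |q.1 - q.2| ∂P

/-- The open Wasserstein ball of radius `ε` around `G₀` among finite mixing distributions. -/
def wBall (Θ : Set ℝ) (G₀ : Measure ℝ) (ε : ℝ) : Set (Measure ℝ) :=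
  {G | G ∈ mixingFinite Θ ∧ W G G₀ < ENNReal.ofReal ε}

end FiniteMixture

end

/-! Close to `G₀`, a measure with at most `m` atoms has exactly one atom near each of the `m` atoms
of `G₀` (`exists_atomic_of_W_lt`). Hence `G₁` and `G₂` have masses `p`, `q` and locations `a`, `b`
indexed by the support of `G₀`, and can be compared through `N = ∑ (|p j - q j| + q j * |a j - b
j|)`. Expanding at the atoms `θ j` of `G₀`, the difference of the distribution functions is `∑ ((p j
- q j) F(x, θ j) + q j (a j - b j) F'(x, θ j))` up to a small multiple of `N`. By strong
identifiability this linear form in the coefficients vanishes for all `x` only at zero, so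
compactness of the unit sphere bounds it below by `c * N` at one of finitely many `x`
(`exists_finset_lower_bound`). The remainder costs at most half of that
(`exists_param_lower_bound`). Conversely `W G₁ G₂ ≤ (1 + diam Θ) * N` by an explicit coupling
(`W_atomic_le_param`), and `N` cancels in the ratio. -/

namespace FiniteMixture

/-! ### Strict differentiability on closed sets with finitely many components -/

section LocalConvexity

theorem isClosed_connectedComponentIn {X : Type*} [TopologicalSpace X] {S : Set X}
    (hS : IsClosed S) (x : X) : IsClosed (connectedComponentIn S x) := by
  by_cases hx : x ∈ S
  · rw [connectedComponentIn_eq_image hx]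
    exact hS.isClosedEmbedding_subtypeVal.isClosedMap _ isClosed_connectedComponent
  · rw [connectedComponentIn_eq_empty hx]
    exact isClosed_empty

/-- A closed subset of `ℝ` with finitely many components is locally convex. -/
theorem exists_convex_inter_ball {S : Set ℝ} (hS : IsClosed S)
    (hfin : (connectedComponentIn S '' S).Finite) (x : ℝ) :
    ∃ r > 0, ∀ s ≤ r, Convex ℝ (S ∩ Metric.ball x s) := by
  -- Finiteness makes the union of the components missing `x` closed, so a small ball around `x`
  -- meets `S` only in the component of `x`, an interval.
  set A : Set ℝ := ⋃ C ∈ {C ∈ connectedComponentIn S '' S | x ∉ C}, C with hA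
  have hAc : IsClosed A := by
    refine (hfin.subset (Set.sep_subset _ _)).isClosed_biUnion ?_
    rintro _ ⟨⟨y, -, rfl⟩, -⟩
    exact isClosed_connectedComponentIn hS y
  have hxA : x ∉ A := by
    simp only [hA, Set.mem_iUnion, not_exists]
    rintro C ⟨-, hxC⟩ h
    exact hxC h
  obtain ⟨r, hr, hrA⟩ := Metric.isOpen_iff.1 hAc.isOpen_compl x hxA
  refine ⟨r, hr, fun s hs => ?_⟩
  have key : S ∩ Metric.ball x s = connectedComponentIn S x ∩ Metric.ball x s := by
    ext y
    constructor
    · rintro ⟨hy, hys⟩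
      refine ⟨?_, hys⟩
      by_contra hcon
      refine hrA (Metric.ball_subset_ball hs hys) ?_
      refine Set.mem_biUnion (x := connectedComponentIn S y) ⟨⟨y, hy, rfl⟩, fun h => hcon ?_⟩
        (mem_connectedComponentIn hy)
      rw [← connectedComponentIn_eq h]
      exact mem_connectedComponentIn hy
    · rintro ⟨hy, hys⟩
      exact ⟨connectedComponentIn_subset S x hy, hys⟩
  rw [key]
  exact isPreconnected_connectedComponentIn.convex.inter (convex_ball x s)

/-- A function on a locally convex set whose derivative is continuous at `x` is strictly
differentiable at `x` relative to the set. -/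
theorem exists_strict_derivWithin_bound {S : Set ℝ} (hS : IsClosed S)
    (hfin : (connectedComponentIn S '' S).Finite) {x : ℝ} {g : ℝ → ℝ}
    (hg : DifferentiableOn ℝ g S) (hg' : ContinuousWithinAt (derivWithin g S) S x)
    {κ : ℝ} (hκ : 0 < κ) :
    ∃ η > 0, ∀ a ∈ S, ∀ b ∈ S, |a - x| < η → |b - x| < η →
      |g a - g b - (a - b) * derivWithin g S x| ≤ κ * |a - b| := by
  obtain ⟨r, hr, hconv⟩ := exists_convex_inter_ball hS hfin x
  obtain ⟨s, hs, hsκ⟩ := Metric.continuousWithinAt_iff.1 hg' κ hκ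
  refine ⟨min r s, lt_min hr hs, fun a ha b hb hax hbx => ?_⟩
  have hC := hconv (min r s) (min_le_left _ _)
  -- Mean value inequality for `g` minus its linear part at `x`, whose derivative is at most `κ` on
  -- the convex set.
  have := hC.norm_image_sub_le_of_norm_hasDerivWithin_le (C := κ) (x := b) (y := a)
    (f := fun t => g t - t * derivWithin g S x)
    (f' := fun t => derivWithin g S t - derivWithin g S x) (fun t ht => ?_) (fun t ht => ?_)
    ⟨hb, by simpa [Real.dist_eq] using hbx⟩ ⟨ha, by simpa [Real.dist_eq] using hax⟩
  · simp only [Real.norm_eq_abs] at this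
    convert this using 2
    ring
  · have h1 := ((hg t ht.1).hasDerivWithinAt).sub
      ((hasDerivWithinAt_id t S).mul_const (derivWithin g S x))
    simp only [one_mul] at h1
    exact h1.mono Set.inter_subset_left
  · have := hsκ ht.1 (lt_of_lt_of_le ht.2 (min_le_right _ _))
    rw [Real.dist_eq] at this
    exact this.le

end LocalConvexity

/-! ### Compactness bound for separating linear functionals -/

section LinearAlgebra

/-- A point-separating family of functionals on `ι → ℝ` is bounded below, uniformly, by finitely
many of its members. -/
theorem exists_finset_lower_bound {ι T : Type*} [Fintype ι] [Inhabited T]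
    (l : T → (ι → ℝ) →ₗ[ℝ] ℝ) (hl : ∀ v, (∀ x, l x v = 0) → v = 0) :
    ∃ (X : Finset T) (c : ℝ), 0 < c ∧ ∀ v, ∃ x ∈ X, c * ∑ i, |v i| ≤ |l x v| := by
  classical
  have hcont : ∀ x, Continuous (l x) := fun x => (l x).continuous_of_finiteDimensional
  obtain ⟨t, ht⟩ := (isCompact_sphere (0 : ι → ℝ) 1).elim_finite_subcover
    (fun q : T × ℕ => {v | 1 / ((q.2 : ℝ) + 1) < |l q.1 v|})
    (fun q => isOpen_lt continuous_const (hcont q.1).abs) (by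
      intro v hv
      have hv0 : v ≠ 0 := by
        rintro rfl
        simp at hv
      have : ∃ x, l x v ≠ 0 := by
        by_contra! h
        exact hv0 (hl v h)
      obtain ⟨x, hx⟩ := this
      obtain ⟨n, hn⟩ := exists_nat_one_div_lt (abs_pos.2 hx)
      exact Set.mem_iUnion.2 ⟨(x, n), hn⟩)
  set N : ℕ := t.sup Prod.snd
  set d : ℝ := Fintype.card ι + 1
  have hd : 0 < d := by positivity
  -- `default` keeps the finite set nonempty for `v = 0`, since `t` may be empty. The factor `d`
  -- passes from the sup norm to the sum.
  refine ⟨insert default (t.image Prod.fst), 1 / ((N : ℝ) + 1) / d, by positivity, fun v => ?_⟩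
  by_cases hv : v = 0
  · exact ⟨default, by simp, by simp [hv]⟩
  have hnv : 0 < ‖v‖ := norm_pos_iff.2 hv
  have hmem : ‖v‖⁻¹ • v ∈ Metric.sphere (0 : ι → ℝ) 1 := by
    simp [norm_smul, hnv.ne']
  obtain ⟨q, hq, hqv⟩ := Set.mem_iUnion₂.1 (ht hmem)
  refine ⟨q.1, by simp only [Finset.mem_insert, Finset.mem_image]; exact .inr ⟨q, hq, rfl⟩, ?_⟩
  simp only [Set.mem_ofPred_eq, map_smul, smul_eq_mul, abs_mul, abs_inv, abs_norm] at hqv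
  have hqN : (q.2 : ℝ) ≤ N := by exact_mod_cast Finset.le_sup (f := Prod.snd) hq
  have h1 : 1 / ((N : ℝ) + 1) ≤ 1 / ((q.2 : ℝ) + 1) := by gcongr
  have h2 : 1 / ((N : ℝ) + 1) * ‖v‖ ≤ |l q.1 v| := by
    have := (h1.trans_lt hqv).le
    rwa [inv_mul_eq_div, le_div_iff₀ hnv] at this
  have h3 : ∑ i, |v i| ≤ d * ‖v‖ := by
    calc ∑ i, |v i| ≤ ∑ _i : ι, ‖v‖ := Finset.sum_le_sum fun i _ => norm_le_pi_norm v i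
      _ = Fintype.card ι * ‖v‖ := by simp
      _ ≤ d * ‖v‖ := by gcongr; simp [d]
  calc 1 / ((N : ℝ) + 1) / d * ∑ i, |v i| ≤ 1 / ((N : ℝ) + 1) / d * (d * ‖v‖) := by gcongr
    _ = 1 / ((N : ℝ) + 1) * ‖v‖ := by field_simp
    _ ≤ _ := h2

end LinearAlgebra

/-! ### Transport between finitely supported measures -/

section Atomic

variable {ι : Type*} [Fintype ι]

/-- The measure with mass `p j` at the point `a j`. -/
noncomputable def atomic {X : Type*} [MeasurableSpace X] (p : ι → ℝ) (a : ι → X) : Measure X :=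
  ∑ j, ENNReal.ofReal (p j) • Measure.dirac (a j)

theorem integral_atomic {p : ι → ℝ} (hp : ∀ j, 0 ≤ p j) (a : ι → ℝ) (g : ℝ → ℝ) :
    ∫ t, g t ∂atomic p a = ∑ j, p j * g (a j) := by
  rw [atomic, integral_finsetSum_measure]
  · simp [integral_smul_measure, hp]
  · intro j _
    exact (integrable_dirac (by simp)).smul_measure ENNReal.ofReal_ne_top

theorem lintegral_atomic {X : Type*} [MeasurableSpace X] (p : ι → ℝ) (a : ι → X)
    {g : X → ℝ≥0∞} (hg : Measurable g) :
    ∫⁻ t, g t ∂atomic p a = ∑ j, ENNReal.ofReal (p j) * g (a j) := by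
  simp [atomic, lintegral_finsetSum_measure, lintegral_dirac' _ hg]

theorem map_atomic {X Y : Type*} [MeasurableSpace X] [MeasurableSpace Y] (p : ι → ℝ) (a : ι → X)
    {g : X → Y} (hg : Measurable g) : (atomic p a).map g = atomic p (g ∘ a) := by
  rw [atomic, Measure.map_finset_sum' hg.aemeasurable]
  simp [atomic, Measure.map_smul, Measure.map_dirac' hg]

/-- The transportation cost of a matrix coupling bounds the Wasserstein distance. -/
theorem W_atomic_le {p q a b : ι → ℝ} {w : ι → ι → ℝ} (hw : ∀ i j, 0 ≤ w i j)
    (hrow : ∀ i, ∑ j, w i j = p i) (hcol : ∀ j, ∑ i, w i j = q j) :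
    W (atomic p a) (atomic q b) ≤ ENNReal.ofReal (∑ i, ∑ j, w i j * |a i - b j|) := by
  set P : Measure (ℝ × ℝ) := atomic (fun k : ι × ι => w k.1 k.2) (fun k => (a k.1, b k.2)) with hP
  have hfst : P.map Prod.fst = atomic p a := by
    rw [hP, map_atomic _ _ measurable_fst]
    simp only [atomic, Fintype.sum_prod_type, Function.comp_def, ← hrow, ← Finset.sum_smul]
    exact Finset.sum_congr rfl fun i _ => by rw [ENNReal.ofReal_sum_of_nonneg fun j _ => hw i j]
  have hsnd : P.map Prod.snd = atomic q b := by
    rw [hP, map_atomic _ _ measurable_snd]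
    simp only [atomic, Fintype.sum_prod_type_right, Function.comp_def, ← hcol, ← Finset.sum_smul]
    exact Finset.sum_congr rfl fun j _ => by rw [ENNReal.ofReal_sum_of_nonneg fun i _ => hw i j]
  refine (iInf₂_le P ⟨hfst, hsnd⟩).trans (le_of_eq ?_)
  rw [hP, lintegral_atomic _ _ (by fun_prop), ← Fintype.sum_prod_type',
      ENNReal.ofReal_sum_of_nonneg fun k _ => mul_nonneg (hw _ _) (abs_nonneg _)]
  exact Finset.sum_congr rfl fun k _ => (ENNReal.ofReal_mul (hw _ _)).symm

/-- Comparison of the Wasserstein distance with the distance of the parameters. -/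
theorem W_atomic_le_param {p q a b : ι → ℝ} (hp : ∀ i, 0 ≤ p i) (hq : ∀ i, 0 ≤ q i)
    (hpq : ∑ i, p i = ∑ i, q i) {D : ℝ} (hD : ∀ i j, |a i - b j| ≤ D) :
    W (atomic p a) (atomic q b) ≤
      ENNReal.ofReal (∑ i, q i * |a i - b i| + D * ∑ i, |p i - q i|) := by
  classical
  -- The common mass `min (p i) (q i)` travels from `a i` to `b i`; the excesses `u` and `v`, of
  -- equal total `R`, are matched by the product coupling `u i * v j / R`.
  set u : ι → ℝ := fun i => p i - min (p i) (q i) with hu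
  set v : ι → ℝ := fun i => q i - min (p i) (q i) with hv
  set R : ℝ := ∑ i, u i with hR
  have hu0 : ∀ i, 0 ≤ u i := fun i => sub_nonneg.2 (min_le_left _ _)
  have hv0 : ∀ i, 0 ≤ v i := fun i => sub_nonneg.2 (min_le_right _ _)
  have hRv : ∑ i, v i = R := by simp only [hR, hu, hv, Finset.sum_sub_distrib, hpq]
  have hR0 : 0 ≤ R := Finset.sum_nonneg fun i _ => hu0 i
  -- If `R = 0`, the quotient is `0` by convention, and so is every `u i`.
  have huR : ∀ i, u i * R / R = u i := fun i => by
    by_cases h : R = 0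
    · have : u i = 0 := (Finset.sum_eq_zero_iff_of_nonneg fun i _ => hu0 i).1 h i (by simp)
      simp [this]
    · field_simp
  have hvR : ∀ i, R * v i / R = v i := fun i => by
    by_cases h : R = 0
    · have : v i = 0 :=
        (Finset.sum_eq_zero_iff_of_nonneg fun i _ => hv0 i).1 (hRv.trans h) i (by simp)
      simp [this]
    · field_simp
  have hw : ∀ i j, 0 ≤ u i * v j / R := fun i j => div_nonneg (mul_nonneg (hu0 i) (hv0 j)) hR0
  have hrow : ∀ i, ∑ j, u i * v j / R = u i := fun i => by
    rw [← Finset.sum_div, ← Finset.mul_sum, hRv, huR]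
  refine (W_atomic_le (w := fun i j => (if i = j then min (p i) (q i) else 0) + u i * v j / R)
    (fun i j => add_nonneg (by split_ifs <;> simp [hp, hq]) (hw i j)) (fun i => ?_)
    (fun j => ?_)).trans (ENNReal.ofReal_le_ofReal ?_)
  · rw [Finset.sum_add_distrib, hrow]
    simp [hu]
  · rw [Finset.sum_add_distrib, ← Finset.sum_div, ← Finset.sum_mul, ← hR, hvR]
    simp [hv]
  · simp only [add_mul, Finset.sum_add_distrib, ite_mul, zero_mul, Finset.sum_ite_eq,
      Finset.mem_univ, if_true]
    refine add_le_add (Finset.sum_le_sum fun i _ => ?_) ?_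
    · gcongr
      exact min_le_right _ _
    · calc ∑ i, ∑ j, u i * v j / R * |a i - b j| ≤ ∑ i, ∑ j, u i * v j / R * D :=
            Finset.sum_le_sum fun i _ => Finset.sum_le_sum fun j _ =>
              mul_le_mul_of_nonneg_left (hD i j) (hw i j)
        _ = ∑ i, D * u i := by
            simp only [← Finset.sum_mul, hrow, mul_comm D]
        _ ≤ ∑ i, D * |p i - q i| := by
            refine Finset.sum_le_sum fun i _ => mul_le_mul_of_nonneg_left ?_
              ((abs_nonneg _).trans (hD i i))
            rcases le_total (p i) (q i) with h | h <;> simp [hu, h, le_abs_self]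
        _ = _ := (Finset.mul_sum _ _ _).symm

end Atomic

end FiniteMixture

/-! ### Localisation of the atoms -/

namespace FiniteMixture

/-- Markov's inequality for couplings: if `G` is `W`-close to `G₀`, then every ball around an atom
of `G₀` carries nearly as much mass of `G`. -/
theorem measure_singleton_le_of_W_lt {G G₀ : Measure ℝ} {η κ : ℝ} (hη : 0 < η)
    (h : W G G₀ < ENNReal.ofReal (η * κ)) (t : ℝ) :
    G₀ {t} ≤ G (Metric.ball t η) + ENNReal.ofReal κ := by
  simp only [W, iInf_lt_iff] at h
  obtain ⟨P, ⟨rfl, rfl⟩, hP⟩ := h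
  rw [Measure.map_apply measurable_snd (measurableSet_singleton t),
    Measure.map_apply measurable_fst measurableSet_ball]
  have hmarkov := mul_meas_ge_le_lintegral (μ := P)
    (f := fun q : ℝ × ℝ => ENNReal.ofReal |q.1 - q.2|) (by fun_prop) (ENNReal.ofReal η)
  rw [ENNReal.ofReal_mul hη.le] at hP
  have hbad : P {q | ENNReal.ofReal η ≤ ENNReal.ofReal |q.1 - q.2|} ≤ ENNReal.ofReal κ :=
    (ENNReal.mul_le_mul_iff_right (by simpa using hη) ENNReal.ofReal_ne_top).1
      (hmarkov.trans hP.le)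
  refine (measure_mono ?_).trans ((measure_union_le _ _).trans (add_le_add_right hbad _))
  rintro ⟨x, y⟩ hy
  obtain rfl : y = t := hy
  by_cases hx : |x - y| < η
  · exact .inl (by simpa [Real.dist_eq] using hx)
  · exact .inr (ENNReal.ofReal_le_ofReal (not_lt.1 hx))

theorem eq_sum_smul_dirac_of_compl_null {G : Measure ℝ} {s : Finset ℝ}
    (hs : G (s : Set ℝ)ᶜ = 0) : G = ∑ t ∈ s, G {t} • Measure.dirac t := by
  ext A hA
  have h1 : G A = G (⋃ t ∈ s, A ∩ {t}) := by
    rw [← Set.inter_iUnion₂]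
    have : (⋃ t ∈ s, ({t} : Set ℝ)) = s := by ext; simp
    rw [this]
    exact (measure_inter_conull hs).symm
  rw [h1, measure_biUnion_finset (fun x _ y _ hxy => by
    simpa [Function.onFun] using (Set.disjoint_singleton.2 hxy).mono Set.inter_subset_right
      Set.inter_subset_right) fun t _ => hA.inter (measurableSet_singleton t)]
  simp only [Measure.coe_finsetSum, Finset.sum_apply, Measure.smul_apply, smul_eq_mul,
    Measure.dirac_apply' _ hA]
  refine Finset.sum_congr rfl fun t _ => ?_
  by_cases ht : t ∈ A
  · simp [ht]
  · simp [ht]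

/-- Near a measure with exactly `m` atoms, the measures with at most `m` atoms have exactly one
atom next to each atom of the centre, of mass bounded below. -/
theorem exists_atomic_of_W_lt {Θ : Set ℝ} {G₀ : Measure ℝ} {s₀ : Finset ℝ}
    {π η : ℝ} (hπ : 0 < π) (hη : 0 < η) (hmass : ∀ t ∈ s₀, ENNReal.ofReal π ≤ G₀ {t})
    (hsep : ∀ x ∈ s₀, ∀ y ∈ s₀, x ≠ y → 2 * η ≤ |x - y|)
    {G : Measure ℝ} (hG : G ∈ mixingLE Θ s₀.card)
    (hW : W G G₀ < ENNReal.ofReal (η * (π / 2))) :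
    ∃ p a : s₀ → ℝ, G = atomic p a ∧ (∀ j, a j ∈ Θ) ∧ (∀ j, |a j - j| < η) ∧ (∀ j, 0 < p j) ∧
      ∑ j, p j = 1 := by
  classical
  simp only [mixingLE, Set.mem_iUnion] at hG
  obtain ⟨m, ⟨-, hm⟩, hprob, s, hsΘ, rfl, hpos, hnull⟩ := hG
  -- A ball without atoms of `G` would force `π ≤ π / 2`.
  have hex : ∀ j : s₀, ∃ t ∈ s, |t - j| < η := by
    intro j
    by_contra! hcon
    have h0 : G (Metric.ball (j : ℝ) η) = 0 := by
      refine measure_mono_null (t := (s : Set ℝ)ᶜ) (fun t ht hts => ?_) hnull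
      rw [Metric.mem_ball, Real.dist_eq] at ht
      exact absurd ht (not_lt.2 (hcon t hts))
    have h1 := (hmass j j.2).trans (measure_singleton_le_of_W_lt hη hW j)
    rw [h0, zero_add, ENNReal.ofReal_le_ofReal_iff (by positivity)] at h1
    linarith
  choose a has ha using hex
  have hinj : Function.Injective a := by
    intro i j hij
    by_contra hne
    have h1 := hsep i i.2 j j.2 (fun h => hne (Subtype.ext h))
    have h2 := abs_sub_le (i : ℝ) (a i) j
    have h3 := ha i
    have h4 := ha j
    rw [← hij] at h4
    rw [abs_sub_comm] at h3
    linarith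
  -- An injection from `s₀` into `s`, which has no more elements, is onto: no atom of `G` is left
  -- over.
  have himg : Finset.univ.image a = s := by
    refine Finset.eq_of_subset_of_card_le (fun t ht => ?_) ?_
    · obtain ⟨j, -, rfl⟩ := Finset.mem_image.1 ht
      exact has j
    · rw [Finset.card_image_of_injective _ hinj]
      simpa using hm
  have hrep : G = atomic (fun j => (G {a j}).toReal) a := by
    conv_lhs => rw [eq_sum_smul_dirac_of_compl_null hnull, ← himg,
      Finset.sum_image fun i _ j _ h => hinj h]
    exact Finset.sum_congr rfl fun j _ => by rw [ENNReal.ofReal_toReal (measure_ne_top _ _)]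
  refine ⟨fun j => (G {a j}).toReal, a, hrep, fun j => hsΘ (has j), ha,
    fun j => ENNReal.toReal_pos (hpos _ (has j)).ne' (measure_ne_top _ _), ?_⟩
  have h1 := integral_atomic (fun j => ENNReal.toReal_nonneg (a := G {a j})) a (fun _ => 1)
  rw [← hrep] at h1
  simpa using h1.symm

/-! ### Identifiability and first-order expansion -/

variable {ν : Measure ℝ} {Θ : Set ℝ} {f : ℝ → ℝ → ℝ}

/-- Under `B(1)`, the values `F(x, θ_j)` and the derivatives `F'(x, θ_j)` at finitely many points
`x` determine the coefficients of a linear combination, with a linear bound. -/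
theorem exists_finset_identifiable (hid : StronglyIdentifiable ν Θ f 1) {s : Finset ℝ}
    (hs : (s : Set ℝ) ⊆ Θ) :
    ∃ (X : Finset ℝ) (c : ℝ), 0 < c ∧ ∀ α β : s → ℝ, ∃ x ∈ X,
      c * ∑ j, (|α j| + |β j|) ≤
        |∑ j : s, (α j * distFun ν f x j + β j * derivWithin (distFun ν f x) Θ j)| := by
  classical
  let l : ℝ → (s ⊕ s → ℝ) →ₗ[ℝ] ℝ := fun x =>
    ∑ j : s, (distFun ν f x j • LinearMap.proj (Sum.inl j) +
      derivWithin (distFun ν f x) Θ j • LinearMap.proj (Sum.inr j))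
  have hl : ∀ x v, l x v = ∑ j : s, (v (.inl j) * distFun ν f x j +
      v (.inr j) * derivWithin (distFun ν f x) Θ j) := fun x v => by
    simp [l, mul_comm]
  obtain ⟨X, c, hc, h⟩ := exists_finset_lower_bound l (fun v hv => by
    let α : ℕ → ℝ → ℝ := fun p t =>
      if ht : t ∈ s then (if p = 0 then v (.inl ⟨t, ht⟩) else v (.inr ⟨t, ht⟩)) else 0
    have h0 := hid s α hs (by
      refine le_antisymm (iSup_le fun x => ?_) zero_le
      refine (ENNReal.ofReal_eq_zero.2 (le_of_eq (abs_eq_zero.2 ?_))).le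
      rw [← hv x, hl]
      simp only [Finset.sum_range_succ, Finset.sum_range_zero, zero_add, distFunDeriv,
        iteratedDerivWithin_zero, iteratedDerivWithin_one, ← Finset.sum_add_distrib]
      rw [← Finset.sum_coe_sort]
      exact Finset.sum_congr rfl fun j _ => by simp [α])
    funext k
    rcases k with j | j
    · simpa [α] using h0 0 (by simp) j j.2
    · simpa [α] using h0 1 le_rfl j j.2)
  refine ⟨X, c, hc, fun α β => ?_⟩
  obtain ⟨x, hx, hcx⟩ := h (Sum.elim α β)
  refine ⟨x, hx, ?_⟩
  rw [hl] at hcx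
  simpa [Finset.sum_add_distrib] using hcx

theorem AssumptionB.differentiableOn (hB : AssumptionB ν Θ f 1) (x : ℝ) :
    DifferentiableOn ℝ (distFun ν f x) Θ := by
  simpa [distFunDeriv] using hB.differentiable x 0 one_pos

theorem AssumptionB.continuousWithinAt (hB : AssumptionB ν Θ f 1) (x : ℝ) {t : ℝ} (ht : t ∈ Θ) :
    ContinuousWithinAt (derivWithin (distFun ν f x) Θ) Θ t := by
  obtain ⟨ω, hω, h⟩ := hB.modulus
  rw [Metric.continuousWithinAt_iff]
  intro κ hκ
  obtain ⟨r, hr, hrω⟩ := Metric.tendsto_nhdsWithin_nhds.1 hω κ hκ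
  refine ⟨r, hr, fun {u} hu hut => ?_⟩
  -- The limit of `ω` is punctured, so `ω 0` may be anything.
  by_cases hne : u = t
  · simpa [hne] using hκ
  have h1 := h t ht u hu x
  have h2 := hrω (x := u - t) (by simpa [sub_eq_zero] using hne)
    (by simpa [Real.dist_eq] using hut)
  simp only [distFunDeriv, iteratedDerivWithin_one] at h1
  rw [Real.dist_eq] at h2 ⊢
  rw [sub_zero] at h2
  exact h1.trans_lt ((le_abs_self _).trans_lt h2)

/-- Near `θ`, mixtures with positive weights satisfy a linear lower bound of the distance of
their distribution functions by the distance of their parameters. -/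
theorem exists_param_lower_bound (hΘ : IsCompact Θ)
    (hfin : (connectedComponentIn Θ '' Θ).Finite) (hB : AssumptionB ν Θ f 1)
    {s : Finset ℝ} (hs : (s : Set ℝ) ⊆ Θ) :
    ∃ c > 0, ∃ η > 0, ∀ p q a b : s → ℝ, (∀ j, 0 < q j) → (∀ j, a j ∈ Θ) → (∀ j, b j ∈ Θ) →
      (∀ j, |a j - j| < η) → (∀ j, |b j - j| < η) → ∃ x,
      c * ∑ j, (|p j - q j| + q j * |a j - b j|) ≤
        |∑ j, p j * distFun ν f x (a j) - ∑ j, q j * distFun ν f x (b j)| := by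
  obtain ⟨X, c, hc, hX⟩ := exists_finset_identifiable hB.identifiable hs
  have hloc : ∀ x : ℝ, ∀ j : s, ∃ η > 0, ∀ a ∈ Θ, ∀ b ∈ Θ, |a - j| < η → |b - j| < η →
      |distFun ν f x a - distFun ν f x j| ≤ c / 2 ∧
      |distFun ν f x a - distFun ν f x b - (a - b) * derivWithin (distFun ν f x) Θ j| ≤
        c / 2 * |a - b| := by
    intro x j
    obtain ⟨η₁, hη₁, h₁⟩ := exists_strict_derivWithin_bound hΘ.isClosed hfin
      (hB.differentiableOn x) (hB.continuousWithinAt x (hs j.2)) (half_pos hc)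
    obtain ⟨η₂, hη₂, h₂⟩ := Metric.continuousWithinAt_iff.1
      ((hB.differentiableOn x).continuousOn j (hs j.2)) (c / 2) (half_pos hc)
    refine ⟨min η₁ η₂, lt_min hη₁ hη₂, fun a ha b hb haj hbj => ⟨?_, ?_⟩⟩
    · exact (h₂ ha (by simpa [Real.dist_eq] using haj.trans_le (min_le_right _ _))).le
    · exact h₁ a ha b hb (haj.trans_le (min_le_left _ _)) (hbj.trans_le (min_le_left _ _))
  choose η hη hloc using hloc
  -- Only finitely many pairs `(x, j)` matter, hence a common radius.
  have hunif : ∃ η₀ > 0, ∀ k ∈ X ×ˢ (Finset.univ : Finset s), η₀ ≤ η k.1 k.2 := by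
    have := (Filter.eventually_all_finset (l := 𝓝[>] (0 : ℝ)) (X ×ˢ (Finset.univ : Finset s))
      (p := fun k e => e ≤ η k.1 k.2)).2 fun k _ =>
        nhdsWithin_le_nhds (eventually_le_nhds (hη k.1 k.2))
    obtain ⟨e, he, h⟩ := (this.and self_mem_nhdsWithin).exists
    exact ⟨e, h, he⟩
  obtain ⟨η₀, hη₀, hle⟩ := hunif
  refine ⟨c / 2, half_pos hc, η₀, hη₀, fun p q a b hq ha hb haj hbj => ?_⟩
  obtain ⟨x, hx, hcx⟩ := hX (fun j => p j - q j) (fun j => q j * (a j - b j))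
  refine ⟨x, ?_⟩
  -- Each remainder is controlled by writing `p F(a) - q F(b) = (p - q) F(a) + q (F(a) - F(b))`.
  have hterm : ∀ j : s, |p j * distFun ν f x (a j) - q j * distFun ν f x (b j) -
      ((p j - q j) * distFun ν f x j +
        q j * (a j - b j) * derivWithin (distFun ν f x) Θ j)| ≤
      c / 2 * (|p j - q j| + q j * |a j - b j|) := by
    intro j
    have hj := hle (x, j) (by simp [hx])
    obtain ⟨h1, h2⟩ := hloc x j (a j) (ha j) (b j) (hb j) ((haj j).trans_le hj)
      ((hbj j).trans_le hj)
    calc _ = |(p j - q j) * (distFun ν f x (a j) - distFun ν f x j) +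
          q j * (distFun ν f x (a j) - distFun ν f x (b j) -
            (a j - b j) * derivWithin (distFun ν f x) Θ j)| := by ring_nf
      _ ≤ |p j - q j| * (c / 2) + q j * (c / 2 * |a j - b j|) := by
          refine (abs_add_le _ _).trans ?_
          rw [abs_mul, abs_mul, abs_of_pos (hq j)]
          gcongr
          exact (hq j).le
      _ = _ := by ring
  have hsum := (Finset.abs_sum_le_sum_abs _ Finset.univ).trans
    (Finset.sum_le_sum fun j _ => hterm j)
  rw [Finset.sum_sub_distrib, Finset.sum_sub_distrib, ← Finset.mul_sum] at hsum
  have habs : ∀ j, |q j * (a j - b j)| = q j * |a j - b j| := fun j => by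
    rw [abs_mul, abs_of_pos (hq j)]
  simp only [habs] at hcx
  set N := ∑ j, (|p j - q j| + q j * |a j - b j|)
  have := abs_sub_abs_le_abs_sub
    (∑ j : s, ((p j - q j) * distFun ν f x j +
      q j * (a j - b j) * derivWithin (distFun ν f x) Θ j))
    (∑ j, p j * distFun ν f x (a j) - ∑ j, q j * distFun ν f x (b j))
  rw [abs_sub_comm (∑ j : s, ((p j - q j) * distFun ν f x j +
      q j * (a j - b j) * derivWithin (distFun ν f x) Θ j))] at this
  linarith

theorem exists_mass_lower_bound {G : Measure ℝ} {s : Finset ℝ} (h : ∀ t ∈ s, 0 < G {t}) :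
    ∃ π > (0 : ℝ), ∀ t ∈ s, ENNReal.ofReal π ≤ G {t} := by
  have hlim : Tendsto ENNReal.ofReal (𝓝[>] 0) (𝓝 0) := by
    simpa using (ENNReal.continuous_ofReal.tendsto 0).mono_left nhdsWithin_le_nhds
  have := (Filter.eventually_all_finset s (p := fun t e => ENNReal.ofReal e ≤ G {t})).2
    fun t ht => (hlim.eventually_lt_const (h t ht)).mono fun _ => le_of_lt
  obtain ⟨e, he, h⟩ := (this.and self_mem_nhdsWithin).exists
  exact ⟨e, h, he⟩

theorem exists_separation (s : Finset ℝ) :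
    ∃ r > (0 : ℝ), ∀ x ∈ s, ∀ y ∈ s, x ≠ y → 2 * r ≤ |x - y| := by
  have := (Filter.eventually_all_finset (l := 𝓝[>] (0 : ℝ)) s.offDiag
    (p := fun k e => e ≤ |k.1 - k.2| / 2)).2 fun k hk =>
      nhdsWithin_le_nhds (eventually_le_nhds
        (half_pos (abs_pos.2 (sub_ne_zero.2 (Finset.mem_offDiag.1 hk).2.2))))
  obtain ⟨e, he, h⟩ := (this.and self_mem_nhdsWithin).exists
  refine ⟨e, h, fun x hx y hy hxy => ?_⟩
  have := he (x, y) (Finset.mem_offDiag.2 ⟨hx, hy, hxy⟩)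
  simp only at this
  linarith

end FiniteMixture

/-! ### The two-sided comparison with `N` -/

theorem theorem4p5
    (ν : MeasureTheory.Measure ℝ) [MeasureTheory.SigmaFinite ν]
    (Θ : Set ℝ) (hΘ : IsCompact Θ) (hΘi : (interior Θ).Nonempty)
    (hΘc : (connectedComponentIn Θ '' Θ).Finite)
    (f : ℝ → ℝ → ℝ) (hf : FiniteMixture.IsDensityFamily ν Θ f)
    (hB : FiniteMixture.AssumptionB ν Θ f 1)
    (m : ℕ) (G₀ : MeasureTheory.Measure ℝ) (hG₀ : G₀ ∈ FiniteMixture.mixing Θ m) :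
    ∃ ε > (0 : ℝ), ∃ δ > (0 : ℝ),
      ENNReal.ofReal δ <
        ⨅ (G₁ ∈ FiniteMixture.mixingLE Θ m ∩ FiniteMixture.wBall Θ G₀ ε)
          (G₂ ∈ FiniteMixture.mixingLE Θ m ∩ FiniteMixture.wBall Θ G₀ ε) (_ : G₁ ≠ G₂),
          FiniteMixture.supNorm (fun x =>
            FiniteMixture.mixDistFun ν f x G₁ - FiniteMixture.mixDistFun ν f x G₂) /
              FiniteMixture.W G₁ G₂ := by
  open FiniteMixture in
  obtain ⟨-, s, hsΘ, rfl, hpos, -⟩ := hG₀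
  obtain ⟨c, hc, η₁, hη₁, hlow⟩ := exists_param_lower_bound hΘ hΘc hB hsΘ
  obtain ⟨η₂, hη₂, hsep⟩ := exists_separation s
  obtain ⟨π, hπ, hmass⟩ := exists_mass_lower_bound hpos
  set η := min η₁ η₂
  have hη : 0 < η := lt_min hη₁ hη₂
  set D := Metric.diam Θ
  have hD : 0 ≤ D := Metric.diam_nonneg
  have hrep := fun G hG hGW => exists_atomic_of_W_lt (Θ := Θ) (G := G) hπ hη hmass
    (fun x hx y hy hxy => le_trans (by gcongr; exact min_le_right _ _) (hsep x hx y hy hxy)) hG hGW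
  -- The radius is the one at which Markov's inequality loses at most mass `π / 2`. The ratio is at
  -- least `c / (1 + D)`; halving makes the inequality strict.
  refine ⟨η * (π / 2), by positivity, c / (1 + D) / 2, by positivity, ?_⟩
  refine lt_of_lt_of_le (b := ENNReal.ofReal (c / (1 + D)))
    ((ENNReal.ofReal_lt_ofReal_iff (by positivity)).2 (half_lt_self (by positivity))) ?_
  refine le_iInf₂ fun G₁ hG₁ => le_iInf₂ fun G₂ hG₂ => le_iInf fun hne => ?_
  obtain ⟨p, a, rfl, ha, haη, hp, hp1⟩ := hrep G₁ hG₁.1 hG₁.2.2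
  obtain ⟨q, b, rfl, hb, hbη, hq, hq1⟩ := hrep G₂ hG₂.1 hG₂.2.2
  obtain ⟨x, hx⟩ := hlow p q a b hq ha hb (fun j => (haη j).trans_le (min_le_left _ _))
    (fun j => (hbη j).trans_le (min_le_left _ _))
  set N := ∑ j, (|p j - q j| + q j * |a j - b j|) with hN
  have hterm : ∀ j, 0 ≤ |p j - q j| + q j * |a j - b j| := fun j =>
    add_nonneg (abs_nonneg _) (mul_nonneg (hq j).le (abs_nonneg _))
  have hN0 : 0 < N := by
    refine lt_of_le_of_ne (Finset.sum_nonneg fun j _ => hterm j) fun h0 => hne ?_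
    have h := (Finset.sum_eq_zero_iff_of_nonneg fun j _ => hterm j).1 h0.symm
    have hpq : p = q ∧ a = b := by
      refine ⟨funext fun j => ?_, funext fun j => ?_⟩ <;>
      · have hj := h j (Finset.mem_univ j)
        have h1 := abs_nonneg (p j - q j)
        have h2 := mul_nonneg (hq j).le (abs_nonneg (a j - b j))
        have h3 : |p j - q j| = 0 := by linarith
        have h4 : q j * |a j - b j| = 0 := by linarith
        first
        | exact sub_eq_zero.1 (abs_eq_zero.1 h3)
        | exact sub_eq_zero.1 (abs_eq_zero.1 ((mul_eq_zero.1 h4).resolve_left (hq j).ne'))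
    rw [hpq.1, hpq.2]
  have hsup : ENNReal.ofReal (c * N) ≤ supNorm (fun x =>
      mixDistFun ν f x (atomic p a) - mixDistFun ν f x (atomic q b)) := by
    refine le_trans ?_ (le_iSup _ x)
    simp only [mixDistFun, integral_atomic (fun j => (hp j).le),
      integral_atomic (fun j => (hq j).le)]
    exact ENNReal.ofReal_le_ofReal hx
  have hW : W (atomic p a) (atomic q b) ≤ ENNReal.ofReal ((1 + D) * N) := by
    refine (W_atomic_le_param (fun j => (hp j).le) (fun j => (hq j).le) (hp1.trans hq1.symm)
      (D := D) fun i j => ?_).trans (ENNReal.ofReal_le_ofReal ?_)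
    · rw [← Real.dist_eq]
      exact Metric.dist_le_diam_of_mem hΘ.isBounded (ha i) (hb j)
    · rw [hN, Finset.sum_add_distrib]
      have h1 : 0 ≤ ∑ j, |p j - q j| := Finset.sum_nonneg fun j _ => abs_nonneg _
      have h2 : 0 ≤ ∑ j, q j * |a j - b j| :=
        Finset.sum_nonneg fun j _ => mul_nonneg (hq j).le (abs_nonneg _)
      nlinarith [mul_nonneg hD h2]
  have hpos' : 0 < ENNReal.ofReal (c * N) := ENNReal.ofReal_pos.2 (mul_pos hc hN0)
  -- A positive numerator and a finite `W` exclude `0 / 0` and `∞ / ∞`; positivity of `W` is not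
  -- needed.
  rw [ENNReal.le_div_iff_mul_le (.inr (hpos'.trans_le hsup).ne')
    (.inl (hW.trans_lt ENNReal.ofReal_lt_top).ne)]
  calc _ ≤ ENNReal.ofReal (c / (1 + D)) * ENNReal.ofReal ((1 + D) * N) := by gcongr
    _ = ENNReal.ofReal (c * N) := by
        rw [← ENNReal.ofReal_mul (by positivity)]
        congr 1
        field_simp
    _ ≤ _ := hsup
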